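/- **Conventions.** A language $L$ consists of relation symbols, each of some finite arity $\ge 1$, and unary function symbols, and $\Gamma_L$ is a group of permutations of $L$ preserving types and arities of symbols. A $\Gamma_L$-structure $\mathbf A$ consists of a vertex set $A$, a relation $R_{\mathbf A}\subseteq A^{n}$ for every $n$-ary relation symbol $R\in L$, and a function $F_{\mathbf A}\colon A\to\mathcal P(A)$ for every function symbol $F\in L$; it is finite if $A$ is finite. An embedding $f\colon\mathbf A\to\mathbf B$ is a pair $(f_L,f_A)$ with $f_L\in\Gamma_L$ and $f_A\colon A\to B$ injective such that $(x_1,\dots,x_n)\in R_{\mathbf A}\iff(f_A(x_1),\dots,f_A(x_n))\in f_L(R)_{\mathbf B}$ and $f_A(F_{\mathbf A}(x))=f_L(F)_{\mathbf B}(f_A(x))$ for all symbols and vertices. It is an isomorphism if $f_A$ is bijective; an automorphism is an isomorphism of a structure to itself; pairs are composed coordinatewise. A substructure of $\mathbf A$ is the structure induced on a set $S\subseteq A$ with $F_{\mathbf A}(x)\subseteq S$ for all $F\in L$ and $x\in S$. For $g\in\Gamma_L$, the relabelled structure $g\mathbf A$ has vertex set $A$ and $S_{g\mathbf A}=(g^{-1}S)_{\mathbf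 A}$ for every symbol $S\in L$; this is the action of $\Gamma_L$ by relabelling. A structure $\mathbf C$ is irreducible if there are no proper substructures with vertex sets $U_1,U_2\subsetneq C$ such that $U_1\cup U_2=C$ and no tuple in a relation of $\mathbf C$ contains both a vertex of $U_1\setminus U_2$ and a vertex of $U_2\setminus U_1$ (that is, $\mathbf C$ is not the free amalgamation of two proper substructures). A partial automorphism of $\mathbf A$ is an isomorphism $f=(f_L,f_A)$ between two substructures of $\mathbf A$. A triple $(f,g,h)$ of partial automorphisms is coherent if $\mathrm{Dom}(f)=\mathrm{Dom}(h)$, $\mathrm{Range}(f)=\mathrm{Dom}(g)$, $\mathrm{Range}(g)=\mathrm{Range}(h)$ and $h=g\circ f$ (also on symbols). A $\Gamma_L$-structure $\mathbf B$ is an irreducible structure faithful coherent EPPA-witness for $\mathbf A$ if there is an embedding $\psi\colon\mathbf A\to\mathbf B$ such that 1. there is a map $f\mapsto\hat f$ from the partial automorphisms of $\psi(\mathbf A)$ to the automorphisms of $\mathbf B$ such that $\hat f$ extends $f$ (with $\hat f_L=f_L$) for every $f$, and $\hat h=\hat g\circ\hat f$ for every coherent triple $(f,g,h)$; and 2. for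 every irreducible substructure $\mathbf C$ of $\mathbf B$ there is an automorphism $\theta$ of $\mathbf B$ with $\theta(C)\subseteq\psi(A)$. **Theorem.** Let $L$ be a language consisting of relation symbols and unary function symbols, equipped with a permutation group $\Gamma_L$, and let $\mathbf A$ be a finite $\Gamma_L$-structure. If $\mathbf A$ lies in a finite orbit of the action of $\Gamma_L$ by relabelling, then there is a finite $\Gamma_L$-structure $\mathbf B$ which is an irreducible structure faithful coherent EPPA-witness for $\mathbf A$. Consequently, if every finite $\Gamma_L$-structure lies in a finite orbit of the action of $\Gamma_L$ by relabelling, then the class of all finite $\Gamma_L$-structures has irreducible structure faithful coherent EPPA: every finite $\Gamma_L$-structure has a finite $\Gamma_L$-structure as an irreducible structure faithful coherent EPPA-witness. -/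

import Mathlib

universe u v w

namespace GammaEPPA

/-- Permutations of the symbols of a language that preserve types (function / relation) and
arities. A permutation group on the language is a subgroup `Γ` of this group. -/
abbrev LangPerm (L : FirstOrder.Language.{u, v}) : Type (max u v) :=
  (∀ n, Equiv.Perm (L.Functions n)) × (∀ n, Equiv.Perm (L.Relations n))

/-- A structure on the vertex set `A`: an `n`-ary function symbol is interpreted as a map from
`n`-tuples of vertices to *sets* of vertices, an `n`-ary relation symbol as a set of `n`-tuples. -/
@[ext]
structure Str (L : FirstOrder.Language.{u, v}) (A : Type w) where
  func : ∀ n : ℕ, L.Functions n → (Fin n → A) → Set A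
  rel : ∀ n : ℕ, L.Relations n → Set (Fin n → A)

variable {L : FirstOrder.Language.{u, v}} {A B : Type w}

/-- The pair consisting of `g` (on symbols) and `f` (on vertices) is an embedding. -/
structure IsEmbedding (g : LangPerm L) (f : A → B) (M : Str L A) (N : Str L B) : Prop where
  injective : Function.Injective f
  map_rel : ∀ (n : ℕ) (R : L.Relations n) (x : Fin n → A),
    x ∈ M.rel n R ↔ f ∘ x ∈ N.rel n (g.2 n R)
  map_func : ∀ (n : ℕ) (F : L.Functions n) (x : Fin n → A),
    f '' M.func n F x = N.func n (g.1 n F) (f ∘ x)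

/-- An embedding of `Γ`-structures: the permutation of the language is part of the data. -/
structure Emb (Γ : Subgroup (LangPerm L)) (M : Str L A) (N : Str L B) where
  lang : Γ
  toFun : A → B
  isEmbedding : IsEmbedding (lang : LangPerm L) toFun M N

/-- An isomorphism of `Γ`-structures: an embedding that is bijective on vertices. -/
structure Iso (Γ : Subgroup (LangPerm L)) (M : Str L A) (N : Str L B) where
  lang : Γ
  toEquiv : A ≃ B
  isEmbedding : IsEmbedding (lang : LangPerm L) toEquiv M N

/-- An automorphism of a `Γ`-structure. -/
abbrev Aut (Γ : Subgroup (LangPerm L)) (M : Str L A) : Type _ := Iso Γ M M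

/-- The action by relabelling: `g • M` is the image of `M` under `(g, id)`, so that a symbol `S`
is interpreted in `g • M` as `g⁻¹ S` is in `M`. -/
instance : MulAction (LangPerm L) (Str L A) where
  smul g M := ⟨fun n F => M.func n (g⁻¹.1 n F), fun n R => M.rel n (g⁻¹.2 n R)⟩
  one_smul _ := rfl
  mul_smul _ _ _ := rfl

/-- `S` is the vertex set of a substructure of `M`, i.e. `S` is closed under the functions. -/
def IsSubstructure (M : Str L A) (S : Set A) : Prop :=
  ∀ (n : ℕ) (F : L.Functions n) (x : Fin n → A), (∀ i, x i ∈ S) → M.func n F x ⊆ S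

/-- The structure induced by `M` on `S`. -/
def Str.induce (M : Str L A) (S : Set A) : Str L S where
  func n F x := {y : S | (y : A) ∈ M.func n F fun i => (x i : A)}
  rel n R := {x : Fin n → S | (fun i => (x i : A)) ∈ M.rel n R}

/-- `M` is the free amalgamation of its substructures on `U₁` and `U₂` (over their intersection,
with respect to the inclusions): the two cover `M`, and a tuple with vertices both in `U₁ \ U₂`
and in `U₂ \ U₁` is in no relation and has empty image under every function. -/
structure IsFreeAmalgamation (M : Str L A) (U₁ U₂ : Set A) : Prop where
  sub_left : IsSubstructure M U₁
  sub_right : IsSubstructure M U₂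
  cover : U₁ ∪ U₂ = Set.univ
  rel_free : ∀ (n : ℕ) (R : L.Relations n) (x : Fin n → A),
    (∃ i, x i ∈ U₁ \ U₂) → (∃ j, x j ∈ U₂ \ U₁) → x ∉ M.rel n R
  func_free : ∀ (n : ℕ) (F : L.Functions n) (x : Fin n → A),
    (∃ i, x i ∈ U₁ \ U₂) → (∃ j, x j ∈ U₂ \ U₁) → M.func n F x = ∅

/-- A structure is irreducible if it is not the free amalgamation of two proper substructures. -/
def IsIrreducible (M : Str L A) : Prop :=
  ¬ ∃ U₁ U₂ : Set A, U₁ ≠ Set.univ ∧ U₂ ≠ Set.univ ∧ IsFreeAmalgamation M U₁ U₂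

/-- A partial automorphism: an isomorphism between two substructures, including a permutation of
the language from `Γ`. -/
structure PartialAut (Γ : Subgroup (LangPerm L)) (M : Str L A) where
  dom : Set A
  ran : Set A
  dom_sub : IsSubstructure M dom
  ran_sub : IsSubstructure M ran
  iso : Iso Γ (M.induce dom) (M.induce ran)

/-- `(f, g, h)` is a coherent triple: the domains and ranges match and `h = g ∘ f`, both on
symbols and on vertices. -/
structure IsCoherentTriple {Γ : Subgroup (LangPerm L)} {M : Str L A}
    (f g h : PartialAut Γ M) : Prop where
  dom_eq : f.dom = h.dom
  mid_eq : f.ran = g.dom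
  ran_eq : g.ran = h.ran
  lang_eq : h.iso.lang = g.iso.lang * f.iso.lang
  map_eq : ∀ x : f.dom,
    (h.iso.toEquiv ⟨x, dom_eq ▸ x.2⟩ : A) =
      g.iso.toEquiv ⟨f.iso.toEquiv x, mid_eq ▸ (f.iso.toEquiv x).2⟩

/-- The structure `ψ(M)`, as a structure on the range of `ψ`. -/
abbrev Emb.image {Γ : Subgroup (LangPerm L)} {M : Str L A} {N : Str L B} (ψ : Emb Γ M N) :
    Str L (Set.range ψ.toFun) :=
  N.induce (Set.range ψ.toFun)

/-- The automorphism `θ` of `N` extends the partial automorphism `p` of `ψ(M)`, on symbols and on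
vertices. -/
def Extends {Γ : Subgroup (LangPerm L)} {M : Str L A} {N : Str L B} {ψ : Emb Γ M N}
    (θ : Aut Γ N) (p : PartialAut Γ ψ.image) : Prop :=
  θ.lang = p.iso.lang ∧
    ∀ x : p.dom, θ.toEquiv ((x : Set.range ψ.toFun) : B) =
      ((p.iso.toEquiv x : Set.range ψ.toFun) : B)

/-- Every partial automorphism of `ψ(M)` extends to an automorphism of `N`, and the extensions can
be chosen such that coherent triples go to coherent triples. -/
def IsCoherentEPPAEmb {Γ : Subgroup (LangPerm L)} {M : Str L A} {N : Str L B}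
    (ψ : Emb Γ M N) : Prop :=
  ∃ φ : PartialAut Γ ψ.image → Aut Γ N,
    (∀ p, Extends (φ p) p) ∧
    ∀ f g h, IsCoherentTriple f g h →
      (φ h).lang = (φ g).lang * (φ f).lang ∧
        ∀ x : B, (φ h).toEquiv x = (φ g).toEquiv ((φ f).toEquiv x)

/-- Every irreducible substructure of `N` is sent by some automorphism of `N` into `ψ(M)`. -/
def IsFaithfulEmb {Γ : Subgroup (LangPerm L)} {M : Str L A} {N : Str L B}
    (ψ : Emb Γ M N) : Prop :=
  ∀ C : Set B, IsSubstructure N C → IsIrreducible (N.induce C) →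
    ∃ θ : Aut Γ N, θ.toEquiv '' C ⊆ Set.range ψ.toFun

/-- `N` is an irreducible structure faithful coherent EPPA-witness for `M`. -/
def IsFaithfulCoherentEPPAWitness (Γ : Subgroup (LangPerm L)) (M : Str L A) (N : Str L B) : Prop :=
  ∃ ψ : Emb Γ M N, IsCoherentEPPAEmb ψ ∧ IsFaithfulEmb ψ

/-- The class `K` of structures has irreducible structure faithful coherent EPPA. -/
def HasFaithfulCoherentEPPA (Γ : Subgroup (LangPerm L)) (K : ∀ A : Type w, Str L A → Prop) : Prop :=
  ∀ (A : Type w) (M : Str L A), K A M →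
    ∃ (B : Type w) (N : Str L B), K B N ∧ IsFaithfulCoherentEPPAWitness Γ M N

/-- `M` lies in a finite orbit of the action of `Γ` by relabelling. -/
def InFiniteOrbit (Γ : Subgroup (LangPerm L)) (M : Str L A) : Prop :=
  (MulAction.orbit Γ M).Finite

end GammaEPPA

/-!
Replace the relations and functions of `M` by the action of `Perm A × Γ` on the structures on `A`:
a partial automorphism is the restriction of a group element `g` to a set `D` on which `g • M` looks
like `M`, and the orbit of `M` is finite.

Give every vertex a function with values in `ZMod 2` on the pairs `(S, m)` of a set of vertices and
a structure in the orbit, such that on the copy of `A` the sum over `S` of the values at `(S, m)`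
tells whether `m` looks like `M` on `S`. Permutations that preserve all these sums restrict on the
copy of `A` only to partial automorphisms. Conversely, a partial automorphism extends to such a
permutation, because the valuations outside its domain `D` can be corrected to make every sum over a
set not contained in `D` vanish. Fixing one correction for each `D` makes the extensions coherent.

To make a set of vertices lie in one copy of `A` as soon as each two of its elements do, colour the
entries of every tuple that enumerates a set in no copy, with one colour less than it has entries. A
copy of `A` uses distinct colours, whereas the vertices of the whole tuple must repeat one.

In the witness, each vertex also remembers which set it generates. The functions are unary, so in an
irreducible substructure any two of these sets lie in a common copy of `A`, hence all of them do.
-/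

namespace GammaEPPA

open Equiv
open scoped Pointwise

/-! ### Coherent extension of partial permutations -/

section PartialPermutations

variable {A : Type*} [Finite A] {D E F : Set A}

theorem card_compl_eq_of_equiv (f : D ≃ E) : Nat.card ↥Dᶜ = Nat.card ↥Eᶜ := by
  have hDE : D.ncard = E.ncard := Nat.card_congr f
  have hD := Set.ncard_add_ncard_compl D
  have hE := Set.ncard_add_ncard_compl E
  rw [Nat.card_coe_set_eq, Nat.card_coe_set_eq]
  omega

/-- The bijection between complements that matches fixed enumerations of the two sides. It depends
only on `D` and `E`, which is what makes `extendPerm` functorial. -/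
noncomputable def complEquiv (f : D ≃ E) : ↥Dᶜ ≃ ↥Eᶜ :=
  (Finite.equivFin ↥Dᶜ).trans
    ((finCongr (card_compl_eq_of_equiv f)).trans (Finite.equivFin ↥Eᶜ).symm)

theorem complEquiv_trans (f : D ≃ E) (g : E ≃ F) :
    complEquiv (f.trans g) = (complEquiv f).trans (complEquiv g) := by
  ext x
  simp only [complEquiv, Equiv.trans_apply, Equiv.apply_symm_apply]
  rfl

open Classical in
/-- The extension of a bijection between subsets of a finite set to a permutation, by
`complEquiv`. -/
noncomputable def extendPerm (f : D ≃ E) : Perm A :=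
  (Equiv.Set.sumCompl D).symm.trans
    ((Equiv.sumCongr f (complEquiv f)).trans (Equiv.Set.sumCompl E))

theorem extendPerm_apply (f : D ≃ E) (x : D) : extendPerm f x = f x := by
  simp [extendPerm]

theorem extendPerm_trans (f : D ≃ E) (g : E ≃ F) :
    extendPerm (f.trans g) = extendPerm g * extendPerm f := by
  ext x
  simp [extendPerm, complEquiv_trans, ← Equiv.sumCongr_trans]

theorem extendPerm_image (f : D ≃ E) : extendPerm f '' D = E := by
  ext y
  constructor
  · rintro ⟨x, hx, rfl⟩
    exact extendPerm_apply f ⟨x, hx⟩ ▸ (f ⟨x, hx⟩).2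
  · intro hy
    refine ⟨f.symm ⟨y, hy⟩, (f.symm ⟨y, hy⟩).2, ?_⟩
    rw [extendPerm_apply, Equiv.apply_symm_apply]

theorem exists_perm_comp_eq {I : Type*} {c d : I → A} (hc : Function.Injective c)
    (hd : Function.Injective d) : ∃ τ : Perm A, ∀ i, τ (c i) = d i := by
  refine ⟨extendPerm ((Equiv.ofInjective c hc).symm.trans (Equiv.ofInjective d hd)), fun i => ?_⟩
  rw [extendPerm_apply _ (⟨c i, i, rfl⟩ : Set.range c), Equiv.trans_apply,
    show (⟨c i, i, rfl⟩ : Set.range c) = Equiv.ofInjective c hc i from rfl,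
    Equiv.symm_apply_apply, Equiv.ofInjective_apply]

end PartialPermutations

/-! ### Realizing partial maps by valuations -/

/-- Permutations of `X` labelled by a group act on `X`. -/
instance {X K : Type*} [Group K] : MulAction (Perm X × K) X :=
  MulAction.compHom X (MonoidHom.fst (Perm X) K)

variable {A B G H : Type*} [Group G] [MulAction G A] [Group H] [MulAction H B]

/-- Let `P D g` say that the restriction of `g` to `D ⊆ A` is an admissible partial map. A
realization of `P` is a set `B ⊇ A`, fibred over `A`, with a group `H` of symmetries that induces
only admissible partial maps on `A` and to which all of these extend, functorially. -/
structure Realization (P : Set A → G → Prop) (H B : Type*) [Group H] [MulAction H B] where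
  label : H →* G
  proj : B → A
  proj_smul : ∀ (h : H) (b : B), proj (h • b) = label h • proj b
  emb : A → B
  proj_emb : ∀ a, proj (emb a) = a
  admissible : ∀ (h : H) (D : Set A), (∀ x ∈ D, h • emb x ∈ Set.range emb) → P D (label h)
  extend : ∀ (D : Set A) (g : G), P D g → H
  label_extend : ∀ (D : Set A) (g : G) (hg : P D g), label (extend D g hg) = g
  extend_smul_emb : ∀ (D : Set A) (g : G) (hg : P D g), ∀ x ∈ D,
    extend D g hg • emb x = emb (g • x)
  extend_mul : ∀ (D E : Set A) (g g' : G) (hg : P D g) (hg' : P E g') (hgg' : P D (g' * g)),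
    g • D = E → extend D (g' * g) hgg' = extend E g' hg' * extend D g hg

section Valuations

attribute [local instance] arrowAction

theorem exists_eqOn_finsum_mem_eq [Finite A] {C : Type*} [AddCommGroup C] {S D : Set A}
    (hSD : ¬ S ⊆ D) (f : A → C) (t : C) :
    ∃ u : A → C, Set.EqOn u f D ∧ ∑ᶠ x ∈ S, u x = t := by
  classical
  obtain ⟨y, hyS, hyD⟩ := Set.not_subset.1 hSD
  obtain ⟨r, hr⟩ : ∃ r, r = ∑ᶠ x ∈ S \ {y}, f x := ⟨_, rfl⟩
  have hne : ∀ x, x ≠ y → Function.update f y (t - r) x = f x := fun x hx =>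
    Function.update_of_ne hx _ _
  refine ⟨Function.update f y (t - r), fun x hx => hne x (by rintro rfl; exact hyD hx), ?_⟩
  rw [← Set.insert_sdiff_self_of_mem hyS, finsum_mem_insert _ (by simp) (Set.toFinite _),
    finsum_mem_congr rfl fun x hx => hne x hx.2, ← hr, Function.update_self, sub_add_cancel]

variable (A) (X : Type*) [MulAction G X]

/-- A valuation gives a bit to every pair of a set of vertices and an index; `Valued A X` is the
set of vertices carrying a valuation. -/
abbrev Valued : Type _ := A × (Set A × X → ZMod 2)

variable {A X}

/-- Adding to each valuation a function that depends on the vertex carrying it. -/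
def translate (u : A → Set A × X → ZMod 2) : Perm (Valued A X) where
  toFun v := (v.1, v.2 + u v.1)
  invFun v := (v.1, v.2 - u v.1)
  left_inv v := by simp
  right_inv v := by simp

theorem finsum_mem_smul_set {C : Type*} [AddCommMonoid C] (g : G) (S : Set A) (f : A → C) :
    ∑ᶠ x ∈ g • S, f x = ∑ᶠ x ∈ S, f (g • x) :=
  finsum_mem_image (MulAction.injective g).injOn

/-- The permutation `π` of `Valued A X` lies above `g` and sends the sum over `S` of the values at
`(S, m)` to the sum over `g • S` of the values at `(g • S, g • m)`, for every choice `c` of a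
valuation at each vertex. -/
structure IsSumPreserving (π : Perm (Valued A X)) (g : G) : Prop where
  fst_apply : ∀ v, (π v).1 = g • v.1
  finsum_apply : ∀ (c : A → Set A × X → ZMod 2) (k : Set A × X),
    ∑ᶠ x ∈ k.1, (π (x, c x)).2 (g • k) = ∑ᶠ x ∈ k.1, c x k

theorem IsSumPreserving.mul {π ρ : Perm (Valued A X)} {g g' : G} (hπ : IsSumPreserving π g)
    (hρ : IsSumPreserving ρ g') : IsSumPreserving (π * ρ) (g * g') := by
  refine ⟨fun v => by simp [hπ.fst_apply, hρ.fst_apply, mul_smul], fun c k => ?_⟩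
  set d : A → Set A × X → ZMod 2 := fun y => (ρ (g'⁻¹ • y, c (g'⁻¹ • y))).2
  have hd (x : A) : ρ (x, c x) = (g' • x, d (g' • x)) :=
    Prod.ext (hρ.fst_apply _) (by simp [d])
  calc ∑ᶠ x ∈ k.1, ((π * ρ) (x, c x)).2 ((g * g') • k)
      = ∑ᶠ x ∈ k.1, (π (g' • x, d (g' • x))).2 (g • g' • k) := by
        simp only [Perm.mul_apply, hd, mul_smul]
    _ = ∑ᶠ y ∈ (g' • k).1, (π (y, d y)).2 (g • g' • k) :=
        (finsum_mem_smul_set g' k.1 fun y => (π (y, d y)).2 (g • g' • k)).symm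
    _ = ∑ᶠ y ∈ (g' • k).1, d y (g' • k) := hπ.finsum_apply d (g' • k)
    _ = ∑ᶠ x ∈ k.1, d (g' • x) (g' • k) :=
        finsum_mem_smul_set g' k.1 fun y => d y (g' • k)
    _ = ∑ᶠ x ∈ k.1, c x k := by
        rw [← hρ.finsum_apply c k]
        simp only [hd]

theorem IsSumPreserving.inv {π : Perm (Valued A X)} {g : G} (hπ : IsSumPreserving π g) :
    IsSumPreserving π⁻¹ g⁻¹ := by
  have hfst (v : Valued A X) : (π⁻¹ v).1 = g⁻¹ • v.1 := by
    rw [eq_inv_smul_iff, ← hπ.fst_apply]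
    simp
  refine ⟨hfst, fun c k => ?_⟩
  set d : A → Set A × X → ZMod 2 := fun x => (π⁻¹ (g • x, c (g • x))).2
  have hd (x : A) : π (x, d x) = (g • x, c (g • x)) := by
    rw [← show π⁻¹ (g • x, c (g • x)) = (x, d x) from
      Prod.ext ((hfst _).trans (inv_smul_smul g x)) rfl]
    exact π.apply_symm_apply _
  calc ∑ᶠ x ∈ k.1, (π⁻¹ (x, c x)).2 (g⁻¹ • k)
      = ∑ᶠ x ∈ g • (g⁻¹ • k).1, (π⁻¹ (x, c x)).2 (g⁻¹ • k) := by simp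
    _ = ∑ᶠ x ∈ (g⁻¹ • k).1, (π (x, d x)).2 (g • g⁻¹ • k) := by
        rw [finsum_mem_smul_set, hπ.finsum_apply]
    _ = ∑ᶠ x ∈ g • (g⁻¹ • k).1, c x k := by
        simp only [finsum_mem_smul_set, hd, smul_inv_smul]
    _ = ∑ᶠ x ∈ k.1, c x k := by simp

variable (A G X) in
/-- The group of the sum-preserving permutations of `Valued A X`, each together with the group
element that it lies above. -/
def sumPreserving : Subgroup (Perm (Valued A X) × G) where
  carrier := {h | IsSumPreserving h.1 h.2}
  one_mem' := ⟨fun v => (one_smul G v.1).symm, fun c k => by simp⟩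
  mul_mem' := IsSumPreserving.mul
  inv_mem' := IsSumPreserving.inv

/-- The action of `g` on `Valued A X`, with the valuations translated by `-u` before and by `u'`
after. It is in `sumPreserving` if the sums of `u` at `(S, m)` equal those of `u'` at
`(g • S, g • m)`. -/
def gaugedAction (g : G) (u u' : A → Set A × X → ZMod 2) : Perm (Valued A X) :=
  translate u' * MulAction.toPermHom G (Valued A X) g * (translate u)⁻¹

theorem gaugedAction_mul (g g' : G) (u u' u'' : A → Set A × X → ZMod 2) :
    gaugedAction (g' * g) u u'' = gaugedAction g' u' u'' * gaugedAction g u u' := by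
  simp only [gaugedAction, map_mul]
  group

theorem gaugedAction_apply (g : G) (u u' : A → Set A × X → ZMod 2) (v : Valued A X) :
    gaugedAction g u u' v = (g • v.1, g • (v.2 - u v.1) + u' (g • v.1)) :=
  rfl

theorem gaugedAction_mem_sumPreserving {g : G} {u u' : A → Set A × X → ZMod 2}
    (h : ∀ k : Set A × X, ∑ᶠ x ∈ (g • k).1, u' x (g • k) = ∑ᶠ x ∈ k.1, u x k) [Finite A] :
    (gaugedAction g u u', g) ∈ sumPreserving A G X := by
  refine ⟨fun v => rfl, fun c k => ?_⟩
  have hval (x : A) : (gaugedAction g u u' (x, c x)).2 (g • k) =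
      c x k - u x k + u' (g • x) (g • k) := by
    rw [gaugedAction_apply]
    change (c x - u x) (g⁻¹ • g • k) + _ = _
    rw [inv_smul_smul]
    rfl
  have hfin : k.1.Finite := Set.toFinite _
  rw [finsum_mem_congr rfl fun x _ => hval x, finsum_mem_add_distrib hfin,
    finsum_mem_sub_distrib _ _ hfin, ← h k, ← finsum_mem_smul_set g k.1 fun y => u' y (g • k)]
  exact sub_add_cancel _ _

variable [Finite A] {P : Set A → G → Prop} (T : Set (Set A × X))

open Classical in
/-- The bit that the valuations of the vertices of `S` should sum to at `(S, m)`. -/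
noncomputable def sectionBit (k : Set A × X) : ZMod 2 := if k ∈ T then 1 else 0

theorem exists_weight : ∃ w : A → Set A × X → ZMod 2,
    ∀ k : Set A × X, k.1.Nonempty → ∑ᶠ x ∈ k.1, w x k = sectionBit T k := by
  have h (k : Set A × X) : ∃ f : A → ZMod 2, k.1.Nonempty → ∑ᶠ x ∈ k.1, f x = sectionBit T k := by
    rcases k.1.eq_empty_or_nonempty with hk | hk
    · exact ⟨0, fun h => absurd hk h.ne_empty⟩
    · obtain ⟨f, -, hf⟩ := exists_eqOn_finsum_mem_eq (D := ∅)
        (fun h => hk.ne_empty (Set.subset_empty_iff.1 h)) (0 : A → ZMod 2) (sectionBit T k)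
      exact ⟨f, fun _ => hf⟩
  choose f hf using h
  exact ⟨fun x k => f k x, hf⟩

/-- The valuations of the embedded copy of `A`: their sum over `S` at `(S, m)` tells whether
`(S, m) ∈ T`. -/
noncomputable def weight : A → Set A × X → ZMod 2 := (exists_weight T).choose

theorem finsum_weight {k : Set A × X} (hk : k.1.Nonempty) :
    ∑ᶠ x ∈ k.1, weight T x k = sectionBit T k :=
  (exists_weight T).choose_spec k hk

open Classical in
theorem exists_gauge (D : Set A) : ∃ u : A → Set A × X → ZMod 2, Set.EqOn u (weight T) D ∧
    ∀ k : Set A × X, k.1.Nonempty → ∑ᶠ x ∈ k.1, u x k = if k.1 ⊆ D then sectionBit T k else 0 := by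
  have h (k : Set A × X) : ∃ f : A → ZMod 2, Set.EqOn f (fun x => weight T x k) D ∧
      (k.1.Nonempty → ∑ᶠ x ∈ k.1, f x = if k.1 ⊆ D then sectionBit T k else 0) := by
    by_cases hkD : k.1 ⊆ D
    · exact ⟨_, Set.eqOn_refl _ _, fun hk => by rw [if_pos hkD, finsum_weight T hk]⟩
    · obtain ⟨f, hfD, hf⟩ := exists_eqOn_finsum_mem_eq hkD (fun x => weight T x k) 0
      exact ⟨f, hfD, fun _ => by rw [if_neg hkD, hf]⟩
  choose f hfD hf using h
  exact ⟨fun x k => f k x, fun x hx => funext fun k => hfD k hx, hf⟩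

/-- Valuations that agree with `weight T` on `D` and whose sums over sections not contained in `D`
vanish. -/
noncomputable def gauge (D : Set A) : A → Set A × X → ZMod 2 := (exists_gauge T D).choose

theorem gauge_eqOn (D : Set A) : Set.EqOn (gauge T D) (weight T) D :=
  (exists_gauge T D).choose_spec.1

open Classical in
theorem finsum_gauge (D : Set A) {k : Set A × X} (hk : k.1.Nonempty) :
    ∑ᶠ x ∈ k.1, gauge T D x k = if k.1 ⊆ D then sectionBit T k else 0 :=
  (exists_gauge T D).choose_spec.2 k hk

variable {T}

theorem gaugedAction_gauge_mem_sumPreserving {D : Set A} {g : G}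
    (hT : ∀ k : Set A × X, k.1 ⊆ D → (k ∈ T ↔ g • k ∈ T)) :
    (gaugedAction g (gauge T D) (gauge T (g • D)), g) ∈ sumPreserving A G X := by
  refine gaugedAction_mem_sumPreserving fun k => ?_
  rcases k.1.eq_empty_or_nonempty with hk | hk
  · simp [hk]
  · rw [finsum_gauge T _ hk, finsum_gauge T _ (k := g • k) (Set.smul_set_nonempty.2 hk)]
    have hsub : (g • k).1 ⊆ g • D ↔ k.1 ⊆ D := Set.smul_set_subset_smul_set_iff
    by_cases hkD : k.1 ⊆ D
    · rw [if_pos (hsub.2 hkD), if_pos hkD]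
      classical exact (if_congr (hT k hkD) rfl rfl).symm
    · rw [if_neg (hsub.not.2 hkD), if_neg hkD]

theorem gaugedAction_gauge_weight {D : Set A} (g : G) {x : A} (hx : x ∈ D) :
    gaugedAction g (gauge T D) (gauge T (g • D)) (x, weight T x) = (g • x, weight T (g • x)) := by
  rw [gaugedAction_apply, gauge_eqOn T D hx, gauge_eqOn T _ (Set.smul_mem_smul_set hx), sub_self]
  change (g • x, 0 + _) = _
  rw [zero_add]

theorem smul_mem_of_smul_weight_mem {D : Set A} (hD : D.Nonempty) {m : X} (hm : (D, m) ∈ T)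
    {h : sumPreserving A G X}
    (hh : ∀ x ∈ D, h • (x, weight T x) ∈ Set.range fun a => (a, weight T a)) :
    (h.1.2 • D, h.1.2 • m) ∈ T := by
  obtain ⟨⟨π, g⟩, hπ, hsum⟩ := h
  have himage (x : A) (hx : x ∈ D) : π (x, weight T x) = (g • x, weight T (g • x)) := by
    obtain ⟨a, ha⟩ := hh x hx
    have hfst : a = g • x := (congrArg Prod.fst ha).trans (hπ _)
    exact ha.symm.trans (by rw [hfst])
  have hbit : sectionBit T (g • D, g • m) = sectionBit T (D, m) := by
    rw [← finsum_weight T (k := (D, m)) hD, ← hsum (weight T) (D, m),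
      ← finsum_weight T (k := (g • D, g • m)) (Set.smul_set_nonempty.2 hD)]
    rw [finsum_mem_congr rfl fun x hx => congrArg (fun v => v.2 (g • (D, m))) (himage x hx)]
    exact finsum_mem_smul_set g D fun y => weight T y (g • D, g • m)
  by_contra hg
  simp [sectionBit, hm, hg] at hbit

/-- The valuations realize every family of partial maps that is determined by sections: `(S, m)`
is in `T` if the structure `m` looks on `S` like the structure `m₀` does. -/
noncomputable def valuationRealization {m₀ : X}
    (hT : ∀ D g, P D g → ∀ k : Set A × X, k.1 ⊆ D → (k ∈ T ↔ g • k ∈ T))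
    (hm₀ : ∀ D, (D, m₀) ∈ T) (hP : ∀ D g, (g • D, g • m₀) ∈ T → P D g) (hempty : ∀ g, P ∅ g) :
    Realization P (sumPreserving A G X) (Valued A X) where
  label := (MonoidHom.snd _ _).comp (Subgroup.subtype _)
  proj := Prod.fst
  proj_smul h v := h.2.1 v
  emb a := (a, weight T a)
  proj_emb _ := rfl
  admissible h D hh := by
    rcases D.eq_empty_or_nonempty with rfl | hD
    · exact hempty _
    · exact hP _ _ (smul_mem_of_smul_weight_mem hD (hm₀ D) hh)
  extend D g hg := ⟨_, gaugedAction_gauge_mem_sumPreserving (hT D g hg)⟩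
  label_extend _ _ _ := rfl
  extend_smul_emb _ g _ _ hx := gaugedAction_gauge_weight g hx
  extend_mul D E g g' hg hg' hgg' hE := by
    subst hE
    exact Subtype.ext (Prod.ext (by
      simp only [Subgroup.coe_mul, Prod.fst_mul, mul_smul]
      exact gaugedAction_mul _ _ _ _ _) rfl)

end Valuations

/-! ### The conformal cover -/

namespace Realization

attribute [local instance] arrowAction

variable {P : Set A → G → Prop} (W : Realization P H B)

theorem emb_injective : Function.Injective W.emb :=
  Function.LeftInverse.injective W.proj_emb

theorem smul_emb_eq {h : H} {x : A} (hx : h • W.emb x ∈ Set.range W.emb) :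
    h • W.emb x = W.emb (W.label h • x) := by
  obtain ⟨a, ha⟩ := hx
  rw [← ha, ← W.proj_emb a, ha, W.proj_smul, W.proj_emb]

/-- The translates of `A` under the symmetries of a realization are its copies of `A`. -/
def InCopy (S : Set B) : Prop := ∃ h : H, S ⊆ h • Set.range W.emb

variable {W}

theorem InCopy.mono {S S' : Set B} (h : W.InCopy S') (hS : S ⊆ S') : W.InCopy S :=
  h.imp fun _ hh => hS.trans hh

theorem inCopy_smul_iff {S : Set B} (h : H) : W.InCopy (h • S) ↔ W.InCopy S := by
  have key (h : H) (S : Set B) (hS : W.InCopy S) : W.InCopy (h • S) := by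
    obtain ⟨k, hk⟩ := hS
    exact ⟨h * k, by rw [mul_smul]; exact Set.smul_set_mono hk⟩
  exact ⟨fun hS => by simpa using key h⁻¹ _ hS, key h S⟩

variable (W)

/-- A set of vertices lies in a copy of `A` as soon as all pairs of its elements do. -/
def IsConformal : Prop :=
  ∀ C : Set B, (∀ b ∈ C, ∀ b' ∈ C, W.InCopy {b, b'}) → W.InCopy C

/-- A bad tuple enumerates a set that lies in no copy of `A`. -/
def IsBad {n : ℕ} (s : Fin n → B) : Prop := Function.Injective s ∧ ¬ W.InCopy (Set.range s)

theorem isBad_smul_iff {n : ℕ} (h : H) (s : Fin n → B) : W.IsBad (h • s) ↔ W.IsBad s := by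
  have hrange : Set.range (h • s) = h • Set.range s := Set.range_comp (h • ·) s
  rw [IsBad, IsBad, hrange, inCopy_smul_iff]
  exact and_congr_left' ((MulAction.injective h).of_comp_iff s)

variable (B) in
/-- The vertices of `B`, each with a choice of a colour for every tuple. There is one colour less
than the tuple has entries, so a family of vertices that covers the tuple repeats a colour. -/
abbrev Cover : Type _ := B × ∀ k : Fin (Nat.card B), (Fin (k + 2) → B) → Fin (k + 1)

/-- The symmetries of the cover: permutations above an element `h` of `H` under which the partition
of the entries of every bad tuple `s` by colour goes to that of `h • s`. -/
def coverGroup : Subgroup (Perm (Cover B) × H) where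
  carrier := {t | (∀ v, (t.1 v).1 = t.2 • v.1) ∧ ∀ k s, W.IsBad s → ∀ v w : Cover B,
    v.1 ∈ Set.range s → w.1 ∈ Set.range s →
      ((t.1 v).2 k (t.2 • s) = (t.1 w).2 k (t.2 • s) ↔ v.2 k s = w.2 k s)}
  one_mem' := ⟨fun v => (one_smul H v.1).symm, fun k s _ v w _ _ => by simp⟩
  mul_mem' := by
    rintro ⟨π, h⟩ ⟨ρ, h'⟩ ⟨hπ, cπ⟩ ⟨hρ, cρ⟩
    refine ⟨fun v => by simp [hπ, hρ, mul_smul], fun k s hs v w hv hw => ?_⟩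
    have hmem {v : Cover B} (hv : v.1 ∈ Set.range s) : (ρ v).1 ∈ Set.range (h' • s) := by
      obtain ⟨i, hi⟩ := hv
      exact ⟨i, (congrArg (h' • ·) hi).trans (hρ v).symm⟩
    rw [← cρ k s hs v w hv hw, ← cπ k (h' • s) ((W.isBad_smul_iff h' s).2 hs) _ _ (hmem hv)
      (hmem hw), smul_smul]
    rfl
  inv_mem' := by
    rintro ⟨π, h⟩ ⟨hπ, cπ⟩
    have hπ' (v : Cover B) : (π⁻¹ v).1 = h⁻¹ • v.1 := by
      rw [eq_inv_smul_iff, ← hπ]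
      simp
    refine ⟨hπ', fun k s hs v w hv hw => ?_⟩
    have hmem {v : Cover B} (hv : v.1 ∈ Set.range s) : (π⁻¹ v).1 ∈ Set.range (h⁻¹ • s) := by
      obtain ⟨i, hi⟩ := hv
      exact ⟨i, (congrArg (h⁻¹ • ·) hi).trans (hπ' v).symm⟩
    have key := cπ k (h⁻¹ • s) ((W.isBad_smul_iff h⁻¹ s).2 hs) _ _ (hmem hv) (hmem hw)
    simpa using key.symm

theorem fst_smul (t : W.coverGroup) (v : Cover B) : (t • v).1 = t.1.2 • v.1 :=
  t.2.1 v

/-- Lying above distinct vertices, with distinct colours at every bad tuple through them. -/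
def IsGeneric {I : Type*} (e : I → Cover B) : Prop :=
  Function.Injective (fun i => (e i).1) ∧
    ∀ k s, W.IsBad s → Set.InjOn (fun i => (e i).2 k s) {i | (e i).1 ∈ Set.range s}

variable {W} in
theorem IsGeneric.smul {I : Type*} {e : I → Cover B} (he : W.IsGeneric e) (t : W.coverGroup) :
    W.IsGeneric (fun i => t • e i) := by
  refine ⟨fun i j hij => he.1 ?_, fun k s hs i hi j hj hij => ?_⟩
  · simpa only [fst_smul, smul_left_cancel_iff] using hij
  · have hmem {i : I} (hi : (t • e i).1 ∈ Set.range s) : (e i).1 ∈ Set.range (t.1.2⁻¹ • s) := by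
      obtain ⟨j, hj⟩ := hi
      exact ⟨j, inv_smul_eq_iff.2 (hj.trans (W.fst_smul t (e i)))⟩
    have hs' := (W.isBad_smul_iff t.1.2⁻¹ s).2 hs
    have hcolour := t.2.2 k _ hs' (e i) (e j) (hmem hi) (hmem hj)
    rw [smul_inv_smul] at hcolour
    exact he.2 k _ hs' (hmem hi) (hmem hj) (hcolour.1 hij)

theorem exists_colour_perms {I : Type*} {e e' : I → Cover B} (he : W.IsGeneric e)
    (he' : W.IsGeneric e') (hee' : ∀ i, (e i).1 = (e' i).1) (k : Fin (Nat.card B))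
    (s : Fin (k + 2) → B) : ∃ τ : B → Perm (Fin (k + 1)),
      (W.IsBad s → ∀ b ∈ Set.range s, ∀ b' ∈ Set.range s, τ b = τ b') ∧
      ∀ i, τ (e i).1 ((e i).2 k s) = (e' i).2 k s := by
  classical
  set τ₀ : B → Perm (Fin (k + 1)) :=
    Function.extend (fun i => (e i).1) (fun i => Equiv.swap ((e i).2 k s) ((e' i).2 k s)) 1
  have hτ₀ (i : I) : τ₀ (e i).1 ((e i).2 k s) = (e' i).2 k s := by
    rw [show τ₀ (e i).1 = _ from he.1.extend_apply _ _ i, Equiv.swap_apply_left]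
  by_cases hs : W.IsBad s
  · have hinj' : Set.InjOn (fun i => (e' i).2 k s) {i | (e i).1 ∈ Set.range s} := by
      simpa only [hee'] using he'.2 k s hs
    obtain ⟨τ₁, hτ₁⟩ := exists_perm_comp_eq (he.2 k s hs).injective hinj'.injective
    refine ⟨fun b => if b ∈ Set.range s then τ₁ else τ₀ b, fun _ b hb b' hb' => ?_, fun i => ?_⟩
    · simp only [if_pos hb, if_pos hb']
    · dsimp only
      split_ifs with hi
      · exact hτ₁ ⟨i, hi⟩
      · exact hτ₀ i
  · exact ⟨τ₀, fun h => absurd h hs, hτ₀⟩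

theorem exists_smul_eq_of_isGeneric {I : Type*} {e e' : I → Cover B} (he : W.IsGeneric e)
    (he' : W.IsGeneric e') (hee' : ∀ i, (e i).1 = (e' i).1) :
    ∃ t : W.coverGroup, t.1.2 = 1 ∧ ∀ i, t • e i = e' i := by
  choose τ hτbad hτ using W.exists_colour_perms he he' hee'
  set π : Perm (Cover B) :=
    { toFun v := (v.1, fun k s => τ k s v.1 (v.2 k s))
      invFun v := (v.1, fun k s => (τ k s v.1)⁻¹ (v.2 k s))
      left_inv v := by simp
      right_inv v := by simp }
  have hmem : (π, (1 : H)) ∈ W.coverGroup := by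
    refine ⟨fun v => (one_smul H v.1).symm, fun k s hs v w hv hw => ?_⟩
    rw [one_smul]
    change τ k s v.1 (v.2 k s) = τ k s w.1 (w.2 k s) ↔ _
    rw [hτbad k s hs v.1 hv w.1 hw, EmbeddingLike.apply_eq_iff_eq]
  exact ⟨⟨_, hmem⟩, rfl, fun i => Prod.ext (hee' i) (funext fun k => funext fun s => hτ k s i)⟩

/-- A map of the indices of a tuple to the colours that is injective on `J` unless `J` consists of
all indices. -/
noncomputable def indexColour {k : ℕ} (J : Set (Fin (k + 2))) : Fin (k + 2) → Fin (k + 1) :=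
  Function.invFun (Fin.succAbove (Classical.epsilon (· ∉ J)))

theorem indexColour_injOn {k : ℕ} {J : Set (Fin (k + 2))} (hJ : J ≠ Set.univ) :
    Set.InjOn (indexColour J) J := by
  have hp : Classical.epsilon (· ∉ J) ∉ J :=
    Classical.epsilon_spec ((Set.ne_univ_iff_exists_notMem J).1 hJ)
  have hsucc {i : Fin (k + 2)} (hi : i ∈ J) :
      Fin.succAbove (Classical.epsilon (· ∉ J)) (indexColour J i) = i := by
    refine Function.invFun_eq (Fin.exists_succAbove_eq ?_)
    rintro rfl
    exact hp hi
  intro i hi j hj hij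
  rw [← hsucc hi, hij, hsucc hj]

/-- The vertices of `A` in the cover. At a bad tuple, those from `D` get distinct colours, which
only depend on the positions in the tuple that `D` occupies. -/
noncomputable def coverEmb (D : Set A) (a : A) : Cover B :=
  (W.emb a, fun _ s => Function.extend s (indexColour (s ⁻¹' (W.emb '' D))) (fun _ => 0) (W.emb a))

theorem coverEmb_colour (D : Set A) (a : A) (k : Fin (Nat.card B)) (s : Fin (k + 2) → B) :
    (W.coverEmb D a).2 k s =
      Function.extend s (indexColour (s ⁻¹' (W.emb '' D))) (fun _ => 0) (W.emb a) :=
  rfl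

theorem isGeneric_coverEmb {I : Type*} {D : Set A} {a : I → A} (ha : Function.Injective a)
    (haD : ∀ i, a i ∈ D) : W.IsGeneric (fun i => W.coverEmb D (a i)) := by
  refine ⟨W.emb_injective.comp ha, ?_⟩
  rintro k s ⟨hs, hbad⟩ x ⟨i, hi⟩ y ⟨j, hj⟩ hxy
  have hJ : s ⁻¹' (W.emb '' D) ≠ Set.univ := fun hJ => hbad ⟨1, by
    rw [one_smul, Set.range_subset_iff]
    exact fun i => Set.image_subset_range _ _ (Set.eq_univ_iff_forall.1 hJ i)⟩
  have hmem {x : I} {i : Fin (k + 2)} (hi : s i = W.emb (a x)) : i ∈ s ⁻¹' (W.emb '' D) :=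
    ⟨a x, haD x, hi.symm⟩
  have hcolour {x : I} {i : Fin (k + 2)} (hi : s i = W.emb (a x)) :
      (W.coverEmb D (a x)).2 k s = indexColour (s ⁻¹' (W.emb '' D)) i := by
    rw [coverEmb_colour, ← hi, hs.extend_apply]
  have hij := indexColour_injOn hJ (hmem hi) (hmem hj)
    ((hcolour hi).symm.trans (hxy.trans (hcolour hj)))
  exact ha (W.emb_injective (hi.symm.trans (hij ▸ hj)))

theorem smul_coverEmb {D : Set A} {h : H} (hh : ∀ x ∈ D, h • W.emb x = W.emb (W.label h • x))
    {a : A} (ha : a ∈ D) : h • W.coverEmb D a = W.coverEmb (W.label h • D) (W.label h • a) := by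
  have hD : h • W.emb '' D = W.emb '' (W.label h • D) := by
    simp only [← Set.image_smul, Set.image_image]
    exact Set.image_congr hh
  refine Prod.ext (hh a ha) (funext fun k => funext fun s => ?_)
  have hJ : (h⁻¹ • s) ⁻¹' (W.emb '' D) = s ⁻¹' (W.emb '' (W.label h • D)) := by
    rw [← hD]
    ext i
    exact Set.mem_smul_set_iff_inv_smul_mem.symm
  have hsmul : (h • W.coverEmb D a).2 k s = (W.coverEmb D a).2 k (h⁻¹ • s) := rfl
  rw [hsmul, coverEmb_colour, coverEmb_colour, hJ, ← hh a ha]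
  classical
  simp only [Function.extend_def, Pi.smul_apply, inv_smul_eq_iff]

/-- The action of `h` on the cover. -/
def coverLift (h : H) : W.coverGroup :=
  ⟨(MulAction.toPermHom H (Cover B) h, h), fun _ => rfl, fun k s _ v w _ _ => by
    change v.2 k (h⁻¹ • h • s) = w.2 k (h⁻¹ • h • s) ↔ _
    rw [inv_smul_smul]⟩

theorem coverLift_mul (h h' : H) : W.coverLift (h' * h) = W.coverLift h' * W.coverLift h :=
  Subtype.ext (Prod.ext (map_mul _ _ _) rfl)

theorem exists_coverGauge (D : Set A) : ∃ t : W.coverGroup, t.1.2 = 1 ∧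
    ∀ x ∈ D, t • W.coverEmb D x = W.coverEmb Set.univ x := by
  obtain ⟨t, ht, h⟩ := W.exists_smul_eq_of_isGeneric
    (W.isGeneric_coverEmb (a := ((↑) : D → A)) Subtype.val_injective Subtype.prop)
    (W.isGeneric_coverEmb Subtype.val_injective fun _ => Set.mem_univ _) fun _ => rfl
  exact ⟨t, ht, fun x hx => h ⟨x, hx⟩⟩

/-- A recolouring that moves `coverEmb D` to the embedding of `A` into the cover. -/
noncomputable def coverGauge (D : Set A) : W.coverGroup := (W.exists_coverGauge D).choose

theorem coverGauge_snd (D : Set A) : (W.coverGauge D).1.2 = 1 :=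
  (W.exists_coverGauge D).choose_spec.1

theorem coverGauge_smul {D : Set A} {x : A} (hx : x ∈ D) :
    W.coverGauge D • W.coverEmb D x = W.coverEmb Set.univ x :=
  (W.exists_coverGauge D).choose_spec.2 x hx

/-- The cover of a realization, as a realization of the same family of partial maps. -/
noncomputable def cover : Realization P W.coverGroup (Cover B) where
  label := W.label.comp ((MonoidHom.snd _ _).comp (Subgroup.subtype _))
  proj v := W.proj v.1
  proj_smul t v := by rw [W.fst_smul, W.proj_smul]; rfl
  emb := W.coverEmb Set.univ
  proj_emb := W.proj_emb
  admissible t D ht := W.admissible t.1.2 D fun x hx => by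
    obtain ⟨a, ha⟩ := ht x hx
    exact ⟨a, (congrArg Prod.fst ha).trans (W.fst_smul t _)⟩
  extend D g hg := W.coverGauge (g • D) * W.coverLift (W.extend D g hg) * (W.coverGauge D)⁻¹
  label_extend D g hg := by
    simp [coverGauge_snd, coverLift, W.label_extend]
  extend_smul_emb D g hg x hx := by
    have hlift : W.coverLift (W.extend D g hg) • W.coverEmb D x = W.coverEmb (g • D) (g • x) := by
      have hcover := W.smul_coverEmb (h := W.extend D g hg)
        (by rw [W.label_extend]; exact W.extend_smul_emb D g hg) hx
      rwa [W.label_extend] at hcover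
    rw [mul_smul, mul_smul, ← W.coverGauge_smul hx, inv_smul_smul, hlift,
      W.coverGauge_smul (Set.smul_mem_smul_set hx)]
  extend_mul D E g g' hg hg' hgg' hE := by
    subst hE
    rw [W.extend_mul D _ g g' hg hg' hgg' rfl, coverLift_mul, mul_smul]
    group

theorem isGeneric_of_pairwise_inCopy {C : Set (Cover B)}
    (hC : ∀ v ∈ C, ∀ w ∈ C, W.cover.InCopy {v, w}) : W.IsGeneric (Subtype.val : C → Cover B) := by
  have hcopy (t : W.coverGroup) : W.IsGeneric fun x => t • W.cover.emb x :=
    (W.isGeneric_coverEmb Function.injective_id Set.mem_univ).smul t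
  have hpair (v w : C) : ∃ (t : W.coverGroup) (x y : A),
      t • W.cover.emb x = v.1 ∧ t • W.cover.emb y = w.1 := by
    obtain ⟨t, ht⟩ := hC v v.2 w w.2
    obtain ⟨_, ⟨x, rfl⟩, hx⟩ := ht (Set.mem_insert _ _)
    obtain ⟨_, ⟨y, rfl⟩, hy⟩ := ht (Set.mem_insert_of_mem _ rfl)
    exact ⟨t, x, y, hx, hy⟩
  refine ⟨fun v w hvw => ?_, fun k s hs v hv w hw hvw => ?_⟩
  · obtain ⟨t, x, y, hx, hy⟩ := hpair v w
    simp only [← hx, ← hy] at hvw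
    obtain rfl : x = y := (hcopy t).1 hvw
    exact Subtype.ext (hx.symm.trans hy)
  · obtain ⟨t, x, y, hx, hy⟩ := hpair v w
    simp only [Set.mem_ofPred_eq, ← hx, ← hy] at hvw hv hw
    obtain rfl : x = y := (hcopy t).2 k s hs hv hw hvw
    exact Subtype.ext (hx.symm.trans hy)

theorem inCopy_of_isGeneric [Finite B] {C : Set (Cover B)} (hnontrivial : C.Nontrivial)
    (hC : W.IsGeneric (Subtype.val : C → Cover B)) : W.InCopy (Prod.fst '' C) := by
  by_contra hbad
  obtain ⟨n, hn⟩ := Nat.exists_eq_add_of_le' (Set.one_lt_ncard_iff_nontrivial.2 hnontrivial)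
  have hn' : Nat.card C = n + 2 := hn
  have hcard : n < Nat.card B := by
    have hle : n + 2 ≤ Nat.card B := hn' ▸ Nat.card_le_card_of_injective _ hC.1
    omega
  set c : Fin (n + 2) ≃ C := (finCongr hn'.symm).trans (Finite.equivFin C).symm
  set s : Fin (n + 2) → B := fun i => (c i).1.1
  have hs : W.IsBad s := by
    refine ⟨hC.1.comp c.injective, fun h => hbad (h.mono ?_)⟩
    rintro _ ⟨v, hv, rfl⟩
    exact ⟨c.symm ⟨v, hv⟩, by simp [s]⟩
  obtain ⟨i, j, hij, hcolour⟩ := Fintype.exists_ne_map_eq_of_card_lt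
    (fun i => (c i).1.2 ⟨n, hcard⟩ s) (by simp)
  exact hij (c.injective (hC.2 ⟨n, hcard⟩ s hs ⟨i, rfl⟩ ⟨j, rfl⟩ hcolour))

theorem cover_isConformal [Finite B] : W.cover.IsConformal := by
  intro C hC
  rcases C.subsingleton_or_nontrivial with hsub | hnontrivial
  · rcases hsub.eq_empty_or_singleton with rfl | ⟨v, rfl⟩
    · exact ⟨1, Set.empty_subset _⟩
    · exact (hC v rfl v rfl).mono (Set.singleton_subset_iff.2 (Set.mem_insert v _))
  have hgen := W.isGeneric_of_pairwise_inCopy hC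
  obtain ⟨h, hh⟩ := W.inCopy_of_isGeneric hnontrivial hgen
  have hpre (v : C) : ∃ a, h • W.emb a = v.1.1 := by
    obtain ⟨_, ⟨a, rfl⟩, ha⟩ := hh ⟨v, v.2, rfl⟩
    exact ⟨a, ha⟩
  choose a ha using hpre
  have ha_inj : Function.Injective a := fun v w hvw => hgen.1 <| by
    change v.1.1 = w.1.1
    rw [← ha, ← ha, hvw]
  obtain ⟨t, -, ht⟩ := W.exists_smul_eq_of_isGeneric
    ((W.isGeneric_coverEmb ha_inj fun _ => Set.mem_univ _).smul (W.coverLift h)) hgen ha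
  exact ⟨t * W.coverLift h, fun v hv => ⟨_, ⟨a ⟨v, hv⟩, rfl⟩, (mul_smul _ _ _).trans (ht ⟨v, hv⟩)⟩⟩

end Realization

/-! ### Partial symmetries of a structure -/

section Symmetries

variable {L : FirstOrder.Language.{u, v}} {A : Type w} {Γ : Subgroup (LangPerm L)}

/-- Permutations of the vertices together with permutations of the symbols act on structures by
relabelling both. -/
instance : MulAction (Perm A × Γ) (Str L A) where
  smul g M :=
    ⟨fun n F x => ⇑g.1⁻¹ ⁻¹' M.func n ((g.2 : LangPerm L)⁻¹.1 n F) (⇑g.1⁻¹ ∘ x),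
      fun n R => {x | ⇑g.1⁻¹ ∘ x ∈ M.rel n ((g.2 : LangPerm L)⁻¹.2 n R)}⟩
  one_smul _ := rfl
  mul_smul _ _ _ := rfl

theorem finite_orbit_of_inFiniteOrbit [Finite A] {M : Str L A} (hM : InFiniteOrbit Γ M) :
    (MulAction.orbit (Perm A × Γ) M).Finite := by
  refine ((Set.finite_univ.prod hM).image
    fun q : Perm A × Str L A => ((q.1, 1) : Perm A × Γ) • q.2).subset ?_
  rintro _ ⟨g, rfl⟩
  exact ⟨(g.1, g.2 • M), ⟨Set.mem_univ _, g.2, rfl⟩, rfl⟩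

/-- Two structures agree on the tuples from `S`; the values of the functions at these tuples need
not be contained in `S`. -/
structure AgreeOn (S : Set A) (M N : Str L A) : Prop where
  rel : ∀ (n : ℕ) (R : L.Relations n) (x : Fin n → A), (∀ i, x i ∈ S) →
    (x ∈ M.rel n R ↔ x ∈ N.rel n R)
  func : ∀ (n : ℕ) (F : L.Functions n) (x : Fin n → A), (∀ i, x i ∈ S) →
    M.func n F x = N.func n F x

namespace AgreeOn

variable {S T : Set A} {M N K : Str L A}

theorem refl (S : Set A) (M : Str L A) : AgreeOn S M M :=
  ⟨fun _ _ _ _ => Iff.rfl, fun _ _ _ _ => rfl⟩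

theorem symm (h : AgreeOn S M N) : AgreeOn S N M :=
  ⟨fun n R x hx => (h.rel n R x hx).symm, fun n F x hx => (h.func n F x hx).symm⟩

theorem trans (h : AgreeOn S M N) (h' : AgreeOn S N K) : AgreeOn S M K :=
  ⟨fun n R x hx => (h.rel n R x hx).trans (h'.rel n R x hx),
    fun n F x hx => (h.func n F x hx).trans (h'.func n F x hx)⟩

theorem mono (h : AgreeOn T M N) (hST : S ⊆ T) : AgreeOn S M N :=
  ⟨fun n R x hx => h.rel n R x fun i => hST (hx i),
    fun n F x hx => h.func n F x fun i => hST (hx i)⟩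

theorem smul (h : AgreeOn S M N) (g : Perm A × Γ) : AgreeOn (g • S) (g • M) (g • N) := by
  have hmem {n : ℕ} {x : Fin n → A} (hx : ∀ i, x i ∈ g • S) (i : Fin n) : (⇑g.1⁻¹ ∘ x) i ∈ S :=
    Set.mem_smul_set_iff_inv_smul_mem.1 (hx i)
  exact ⟨fun n R x hx => h.rel n _ _ (hmem hx),
    fun n F x hx => congrArg (⇑g.1⁻¹ ⁻¹' ·) (h.func n _ _ (hmem hx))⟩

theorem smul_iff (g : Perm A × Γ) : AgreeOn (g • S) (g • M) (g • N) ↔ AgreeOn S M N :=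
  ⟨fun h => by simpa only [inv_smul_smul] using h.smul g⁻¹, fun h => h.smul g⟩

theorem isSubstructure (h : AgreeOn T M N) (hST : S ⊆ T) (hS : IsSubstructure M S) :
    IsSubstructure N S := fun n F x hx =>
  (h.func n F x fun i => hST (hx i)) ▸ hS n F x hx

end AgreeOn

theorem agreeOn_empty (hR : IsEmpty (L.Relations 0)) (hF : IsEmpty (L.Functions 0))
    (M N : Str L A) : AgreeOn ∅ M N where
  rel
    | 0, R, _, _ => hR.elim R
    | _ + 1, _, _, hx => (hx 0).elim
  func
    | 0, F, _, _ => hF.elim F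
    | _ + 1, _, _, hx => (hx 0).elim

/-- The restriction of `g` to `D` preserves the structure. -/
def IsSymmetryOn (M : Str L A) (D : Set A) (g : Perm A × Γ) : Prop := AgreeOn D M (g⁻¹ • M)

theorem isSymmetryOn_iff {M : Str L A} {D : Set A} {g : Perm A × Γ} :
    IsSymmetryOn M D g ↔ AgreeOn (g • D) (g • M) M := by
  rw [IsSymmetryOn, ← AgreeOn.smul_iff g, smul_inv_smul]

namespace IsSymmetryOn

variable {M : Str L A} {D : Set A} {g : Perm A × Γ} (h : IsSymmetryOn M D g)
include h

theorem mem_rel_iff {n : ℕ} (R : L.Relations n) {x : Fin n → A} (hx : ∀ i, x i ∈ D) :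
    x ∈ M.rel n R ↔ g.1 ∘ x ∈ M.rel n ((g.2 : LangPerm L).2 n R) :=
  h.rel n R x hx

theorem mem_func_iff {n : ℕ} (F : L.Functions n) {x : Fin n → A} (hx : ∀ i, x i ∈ D) (y : A) :
    y ∈ M.func n F x ↔ g.1 y ∈ M.func n ((g.2 : LangPerm L).1 n F) (g.1 ∘ x) :=
  Set.ext_iff.1 (h.func n F x hx) y

end IsSymmetryOn

/-- The vertex set of the substructure generated by `a`. -/
def vertexClosure (M : Str L A) (a : A) : Set A := ⋂₀ {S | IsSubstructure M S ∧ a ∈ S}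

theorem mem_vertexClosure (M : Str L A) (a : A) : a ∈ vertexClosure M a :=
  fun _ hS => hS.2

theorem isSubstructure_vertexClosure (M : Str L A) (a : A) :
    IsSubstructure M (vertexClosure M a) :=
  fun n _ _ hx _ hy S hS => hS.1 n _ _ (fun i => hx i S hS) hy

theorem vertexClosure_subset {M : Str L A} {S : Set A} (hS : IsSubstructure M S) {a : A}
    (ha : a ∈ S) : vertexClosure M a ⊆ S :=
  Set.sInter_subset_of_mem ⟨hS, ha⟩

theorem IsSubstructure.smul {M : Str L A} {S : Set A} (hS : IsSubstructure M S)
    (g : Perm A × Γ) : IsSubstructure (g • M) (g • S) := fun n _ _ hx _ hy =>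
  Set.mem_smul_set_iff_inv_smul_mem.2
    (hS n _ _ (fun i => Set.mem_smul_set_iff_inv_smul_mem.1 (hx i)) hy)

theorem vertexClosure_smul (M : Str L A) (a : A) (g : Perm A × Γ) :
    vertexClosure (g • M) (g • a) = g • vertexClosure M a := by
  have key (M : Str L A) (a : A) (g : Perm A × Γ) :
      vertexClosure (g • M) (g • a) ⊆ g • vertexClosure M a :=
    vertexClosure_subset ((isSubstructure_vertexClosure M a).smul g)
      (Set.smul_mem_smul_set (mem_vertexClosure M a))
  refine (key M a g).antisymm (Set.smul_set_subset_iff_subset_inv_smul_set.2 ?_)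
  simpa only [inv_smul_smul] using key (g • M) (g • a) g⁻¹

theorem AgreeOn.vertexClosure_eq {M N : Str L A} {T : Set A} (h : AgreeOn T M N)
    (hT : IsSubstructure M T) {a : A} (ha : a ∈ T) : vertexClosure M a = vertexClosure N a := by
  have key {M N : Str L A} (h : AgreeOn T M N) (hT : IsSubstructure M T) :
      vertexClosure N a ⊆ vertexClosure M a :=
    vertexClosure_subset
      (h.isSubstructure (vertexClosure_subset hT ha) (isSubstructure_vertexClosure M a))
      (mem_vertexClosure M a)
  exact (key h.symm (h.isSubstructure subset_rfl hT)).antisymm (key h hT)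

theorem IsSymmetryOn.smul_vertexClosure {M : Str L A} {T : Set A} {g : Perm A × Γ}
    (h : IsSymmetryOn M T g) (hT : IsSubstructure M T) {a : A} (ha : a ∈ T) :
    g • vertexClosure M a = vertexClosure M (g • a) := by
  have hcl := vertexClosure_smul (g⁻¹ • M) a g
  rw [smul_inv_smul] at hcl
  rw [h.vertexClosure_eq hT ha, hcl]

theorem exists_conformal_realization [Finite A] (hR : IsEmpty (L.Relations 0))
    (hF : IsEmpty (L.Functions 0)) {M : Str L A} (hM : InFiniteOrbit Γ M) :
    ∃ (B : Type w) (H : Type (max u v w)) (_ : Finite B) (_ : Group H) (_ : MulAction H B)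
      (W : Realization (IsSymmetryOn (Γ := Γ) M) H B), W.IsConformal := by
  have : Finite (MulAction.orbit (Perm A × Γ) M) := finite_orbit_of_inFiniteOrbit hM
  set X : Type w := Shrink.{w} (MulAction.orbit (Perm A × Γ) M)
  have : Finite X := Finite.of_equiv _ (equivShrink _)
  set str : X → Str L A := fun m => ((equivShrink _).symm m).1
  have str_smul (g : Perm A × Γ) (m : X) : str (g • m) = g • str m :=
    congrArg Subtype.val (equivShrink_symm_smul g m)
  set m₀ : X := equivShrink _ ⟨M, MulAction.mem_orbit_self M⟩
  have str_m₀ : str m₀ = M := by simp [str, m₀]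
  have hT : ∀ D (g : Perm A × Γ), IsSymmetryOn M D g → ∀ k : Set A × X, k.1 ⊆ D →
      (AgreeOn k.1 (str k.2) M ↔ AgreeOn (g • k).1 (str (g • k).2) M) := fun D g hg k hk => by
    have hgM : AgreeOn (g • k.1) (g • M) M :=
      (isSymmetryOn_iff.1 hg).mono (Set.smul_set_mono hk)
    rw [Prod.smul_fst, Prod.smul_snd, str_smul, ← AgreeOn.smul_iff g]
    exact ⟨fun h => h.trans hgM, fun h => h.trans hgM.symm⟩
  set W := valuationRealization (T := {k | AgreeOn k.1 (str k.2) M}) (m₀ := m₀) hT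
    (fun D => by rw [Set.mem_ofPred_eq, str_m₀]; exact AgreeOn.refl D M)
    (fun D g h => isSymmetryOn_iff.2 (by rwa [Set.mem_ofPred_eq, str_smul, str_m₀] at h))
    fun g => agreeOn_empty hR hF M (g⁻¹ • M)
  exact ⟨_, _, inferInstance, _, _, W.cover, W.cover_isConformal⟩

end Symmetries

/-! ### The witness -/

theorem IsEmbedding.mem_func_iff {L : FirstOrder.Language.{u, v}} {A B : Type w} {g : LangPerm L}
    {f : A → B} {M : Str L A} {N : Str L B} (h : IsEmbedding g f M N) {n : ℕ} (F : L.Functions n)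
    (x : Fin n → A) (y : A) : y ∈ M.func n F x ↔ f y ∈ N.func n (g.1 n F) (f ∘ x) := by
  rw [← h.map_func, h.injective.mem_set_image]

theorem isEmbedding_of_equiv {L : FirstOrder.Language.{u, v}} {A B : Type w} {g : LangPerm L}
    {M : Str L A} {N : Str L B} (e : A ≃ B)
    (hrel : ∀ n (R : L.Relations n) (x : Fin n → A), x ∈ M.rel n R ↔ e ∘ x ∈ N.rel n (g.2 n R))
    (hfunc : ∀ n (F : L.Functions n) (x : Fin n → A) (y : A),
      y ∈ M.func n F x ↔ e y ∈ N.func n (g.1 n F) (e ∘ x)) : IsEmbedding g e M N :=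
  ⟨e.injective, hrel, fun n F x => by
    ext y
    obtain ⟨y, rfl⟩ := e.surjective y
    rw [e.injective.mem_set_image, hfunc]⟩

theorem exists_mem_vertexClosure_of_mem_func {L : FirstOrder.Language.{u, v}} {A : Type w}
    (hF : ∀ n : ℕ, n ≠ 1 → IsEmpty (L.Functions n)) {M : Str L A} {n : ℕ} {F : L.Functions n}
    {x : Fin n → A} {y : A} (hy : y ∈ M.func n F x) : ∃ i, y ∈ vertexClosure M (x i) := by
  obtain rfl : n = 1 := by_contra fun hn => (hF n hn).elim F
  refine ⟨0, isSubstructure_vertexClosure M (x 0) 1 F x (fun i => ?_) hy⟩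
  rw [Subsingleton.elim i 0]
  exact mem_vertexClosure M (x 0)

namespace Realization

variable {L : FirstOrder.Language.{u, v}} {A B : Type w} {Γ : Subgroup (LangPerm L)}
  {H : Type*} [Group H] [MulAction H B] {M : Str L A}
  (W : Realization (IsSymmetryOn (Γ := Γ) M) H B)

/-- The vertices of the witness: a vertex of `B`, together with a choice of the vertex set that it
is to generate. The choice is needed because copies of `A` that share a vertex of `B` need not
share the substructure that this vertex generates. -/
def points : SubMulAction H (B × Set B) where
  carrier := {p | ∃ (h : H) (a : A), h • (W.emb a, W.emb '' vertexClosure M a) = p}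
  smul_mem' := by
    rintro h _ ⟨k, a, rfl⟩
    exact ⟨h * k, a, mul_smul _ _ _⟩

/-- The vertices of `A` in the witness. -/
def point (a : A) : W.points := ⟨(W.emb a, W.emb '' vertexClosure M a), 1, a, one_smul _ _⟩

theorem exists_smul_point (p : W.points) : ∃ (h : H) (a : A), h • W.point a = p := by
  obtain ⟨p, h, a, hp⟩ := p
  exact ⟨h, a, Subtype.ext hp⟩

theorem point_injective : Function.Injective W.point := fun _ _ hab =>
  W.emb_injective (congrArg (fun p : W.points => p.1.1) hab)

theorem smul_point {T : Set A} (hT : IsSubstructure M T) {h : H}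
    (hh : ∀ x ∈ T, h • W.emb x ∈ Set.range W.emb) {a : A} (ha : a ∈ T) :
    h • W.point a = W.point (W.label h • a) := by
  refine Subtype.ext (Prod.ext (W.smul_emb_eq (hh a ha)) ?_)
  change h • W.emb '' vertexClosure M a = W.emb '' vertexClosure M (W.label h • a)
  rw [← (W.admissible h T hh).smul_vertexClosure hT ha, ← Set.image_smul, ← Set.image_smul,
    Set.image_image, Set.image_image]
  exact Set.image_congr fun x hx => W.smul_emb_eq (hh x (vertexClosure_subset hT ha hx))

theorem smul_emb_mem_range {h : H} {a b : A} (hab : h • W.point a = W.point b) :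
    ∀ x ∈ vertexClosure M a, h • W.emb x ∈ Set.range W.emb := by
  have hcl : h • W.emb '' vertexClosure M a = W.emb '' vertexClosure M b :=
    congrArg (fun p : W.points => p.1.2) hab
  exact fun x hx => Set.image_subset_range _ _
    (hcl ▸ Set.smul_mem_smul_set (Set.mem_image_of_mem _ hx))

theorem label_smul_eq {h : H} {a b : A} (hab : h • W.point a = W.point b) : W.label h • a = b := by
  have hemb : h • W.emb a = W.emb b := congrArg (fun p : W.points => p.1.1) hab
  rw [← W.proj_emb b, ← hemb, W.proj_smul, W.proj_emb]

theorem isSymmetryOn_range {h : H} {n : ℕ} {x y : Fin n → A}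
    (hxy : h • W.point ∘ x = W.point ∘ y) :
    IsSymmetryOn M (Set.range x) (W.label h) ∧ (W.label h).1 ∘ x = y := by
  refine ⟨W.admissible h _ ?_, funext fun i => W.label_smul_eq (congrFun hxy i)⟩
  rintro _ ⟨i, rfl⟩
  exact W.smul_emb_mem_range (congrFun hxy i) _ (mem_vertexClosure M (x i))

/-- The union of the images under `H` of the structure on `A`, as a structure on `points`. -/
def witness : Str L W.points where
  func n F p := {q | ∃ (h : H) (x : Fin n → A) (y : A),
    y ∈ M.func n (((W.label h).2 : LangPerm L)⁻¹.1 n F) x ∧ h • W.point ∘ x = p ∧ h • W.point y = q}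
  rel n R := {p | ∃ (h : H) (x : Fin n → A),
    x ∈ M.rel n (((W.label h).2 : LangPerm L)⁻¹.2 n R) ∧ h • W.point ∘ x = p}

theorem point_mem_rel_iff {n : ℕ} (R : L.Relations n) (x : Fin n → A) :
    x ∈ M.rel n R ↔ W.point ∘ x ∈ W.witness.rel n R := by
  refine ⟨fun hx => ⟨1, x, by simpa using hx, one_smul _ _⟩, ?_⟩
  rintro ⟨h, y, hy, hyx⟩
  obtain ⟨hsymm, rfl⟩ := W.isSymmetryOn_range hyx
  rw [hsymm.mem_rel_iff _ Set.mem_range_self] at hy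
  simpa using hy

theorem image_point_func (hF : ∀ n : ℕ, n ≠ 1 → IsEmpty (L.Functions n)) {n : ℕ}
    (F : L.Functions n) (x : Fin n → A) :
    W.point '' M.func n F x = W.witness.func n F (W.point ∘ x) := by
  refine Set.Subset.antisymm ?_ ?_
  · rintro _ ⟨y, hy, rfl⟩
    exact ⟨1, x, y, by simpa using hy, one_smul _ _, one_smul _ _⟩
  · rintro _ ⟨h, z, y, hy, hzx, rfl⟩
    obtain ⟨i, hi⟩ := exists_mem_vertexClosure_of_mem_func hF hy
    obtain ⟨hsymm, rfl⟩ := W.isSymmetryOn_range hzx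
    rw [hsymm.mem_func_iff _ Set.mem_range_self] at hy
    exact ⟨(W.label h).1 y, by simpa using hy, (W.smul_point
      (isSubstructure_vertexClosure M (z i)) (W.smul_emb_mem_range (congrFun hzx i)) hi).symm⟩

theorem mem_rel_iff_smul_mem_rel (k : H) {n : ℕ} (R : L.Relations n) (p : Fin n → W.points) :
    p ∈ W.witness.rel n R ↔ k • p ∈ W.witness.rel n (((W.label k).2 : LangPerm L).2 n R) := by
  have key (k : H) {R : L.Relations n} {p : Fin n → W.points} (hp : p ∈ W.witness.rel n R) :
      k • p ∈ W.witness.rel n (((W.label k).2 : LangPerm L).2 n R) := by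
    obtain ⟨h, x, hx, rfl⟩ := hp
    exact ⟨k * h, x, by simpa using hx, mul_smul _ _ _⟩
  exact ⟨key k, fun hp => by simpa using key k⁻¹ hp⟩

theorem mem_func_iff_smul_mem_func (k : H) {n : ℕ} (F : L.Functions n) (p : Fin n → W.points)
    (q : W.points) : q ∈ W.witness.func n F p ↔
      k • q ∈ W.witness.func n (((W.label k).2 : LangPerm L).1 n F) (k • p) := by
  have key (k : H) {F : L.Functions n} {p : Fin n → W.points} {q : W.points}
      (hq : q ∈ W.witness.func n F p) :
      k • q ∈ W.witness.func n (((W.label k).2 : LangPerm L).1 n F) (k • p) := by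
    obtain ⟨h, x, y, hy, rfl, rfl⟩ := hq
    exact ⟨k * h, x, y, by simpa using hy, mul_smul _ _ _, mul_smul _ _ _⟩
  exact ⟨key k, fun hq => by simpa using key k⁻¹ hq⟩

/-- The embedding of the given structure into the witness, with trivial part on the symbols. -/
def witnessEmb (hF : ∀ n : ℕ, n ≠ 1 → IsEmpty (L.Functions n)) : Emb Γ M W.witness where
  lang := 1
  toFun := W.point
  isEmbedding := ⟨W.point_injective, fun _ R x => W.point_mem_rel_iff R x,
    fun _ F x => W.image_point_func hF F x⟩

/-- The automorphism of the witness given by an element of `H`. -/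
def witnessAut (h : H) : Aut Γ W.witness where
  lang := (W.label h).2
  toEquiv := MulAction.toPerm h
  isEmbedding := isEmbedding_of_equiv _ (fun _ => W.mem_rel_iff_smul_mem_rel h)
    (fun _ => W.mem_func_iff_smul_mem_func h)

end Realization

theorem isSubstructure_setOf_notMem_vertexClosure {L : FirstOrder.Language.{u, v}} {A : Type w}
    (hF : ∀ n : ℕ, n ≠ 1 → IsEmpty (L.Functions n)) (M : Str L A) (a : A) :
    IsSubstructure M {z | a ∉ vertexClosure M z} := fun n F x hx y hy ha => by
  obtain ⟨i, hi⟩ := exists_mem_vertexClosure_of_mem_func hF hy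
  exact hx i (vertexClosure_subset (isSubstructure_vertexClosure M (x i)) hi ha)

-- If both alternatives fail, then `M` is the free amalgamation of the substructures of all vertices
-- whose closure omits `a` and of all vertices whose closure omits `b`.
theorem IsIrreducible.exists_common_closure {L : FirstOrder.Language.{u, v}} {A : Type w}
    (hF : ∀ n : ℕ, n ≠ 1 → IsEmpty (L.Functions n)) {M : Str L A} (hM : IsIrreducible M) (a b : A) :
    (∃ z, a ∈ vertexClosure M z ∧ b ∈ vertexClosure M z) ∨
      ∃ (n : ℕ) (R : L.Relations n), ∃ x ∈ M.rel n R, ∃ i j,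
        a ∈ vertexClosure M (x i) ∧ b ∈ vertexClosure M (x j) := by
  by_contra! h
  obtain ⟨hcl, hrel⟩ := h
  have hne (c : A) : {z | c ∉ vertexClosure M z} ≠ Set.univ := fun hc =>
    Set.eq_univ_iff_forall.1 hc c (mem_vertexClosure M c)
  refine hM ⟨{z | a ∉ vertexClosure M z}, {z | b ∉ vertexClosure M z}, hne a, hne b,
    isSubstructure_setOf_notMem_vertexClosure hF M a,
    isSubstructure_setOf_notMem_vertexClosure hF M b,
    Set.eq_univ_iff_forall.2 fun z => or_iff_not_imp_left.2 fun hz => hcl z (not_not.1 hz), ?_, ?_⟩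
  · rintro n R x ⟨i, -, hi⟩ ⟨j, -, hj⟩ hx
    exact hrel n R x hx j i (not_not.1 hj) (not_not.1 hi)
  · rintro n F x ⟨i, hia, -⟩ ⟨j, -, hja⟩
    obtain rfl : n = 1 := by_contra fun hn => (hF n hn).elim F
    exact absurd (Subsingleton.elim i j ▸ hia) hja

namespace Realization

variable {L : FirstOrder.Language.{u, v}} {A B : Type w} {Γ : Subgroup (LangPerm L)}
  {H : Type*} [Group H] [MulAction H B] {M : Str L A}
  (W : Realization (IsSymmetryOn (Γ := Γ) M) H B)

/-- The vertex set in `B` that a vertex of the witness is to generate. -/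
def support (p : W.points) : Set B := p.1.2

theorem support_smul_point_subset (h : H) (a : A) :
    W.support (h • W.point a) ⊆ h • Set.range W.emb :=
  Set.smul_set_mono (Set.image_subset_range _ _)

theorem exists_support_subset_of_mem_func (hF : ∀ n : ℕ, n ≠ 1 → IsEmpty (L.Functions n)) {n : ℕ}
    {F : L.Functions n} {p : Fin n → W.points} {q : W.points} (hq : q ∈ W.witness.func n F p) :
    ∃ i, W.support q ⊆ W.support (p i) := by
  obtain ⟨h, x, y, hy, rfl, rfl⟩ := hq
  obtain ⟨i, hi⟩ := exists_mem_vertexClosure_of_mem_func hF hy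
  exact ⟨i, Set.smul_set_mono (Set.image_mono
    (vertexClosure_subset (isSubstructure_vertexClosure M (x i)) hi))⟩

theorem support_subset_of_mem_vertexClosure (hF : ∀ n : ℕ, n ≠ 1 → IsEmpty (L.Functions n))
    {C : Set W.points} {p q : C} (hp : p ∈ vertexClosure (W.witness.induce C) q) :
    W.support p ⊆ W.support q := by
  refine vertexClosure_subset (S := {p : C | W.support p ⊆ W.support q}) ?_
    (Set.Subset.refl (W.support q)) hp
  intro n F x hx y hy
  obtain ⟨i, hi⟩ := W.exists_support_subset_of_mem_func hF hy
  exact hi.trans (hx i)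

theorem inCopy_support_union (hF : ∀ n : ℕ, n ≠ 1 → IsEmpty (L.Functions n)) {C : Set W.points}
    (hC : IsIrreducible (W.witness.induce C)) (p q : C) :
    W.InCopy (W.support p ∪ W.support q) := by
  rcases hC.exists_common_closure hF p q with ⟨z, hp, hq⟩ | ⟨n, R, x, hx, i, j, hp, hq⟩
  · obtain ⟨h, a, ha⟩ := W.exists_smul_point z
    have hz : W.support z ⊆ h • Set.range W.emb := ha ▸ W.support_smul_point_subset h a
    exact ⟨h, Set.union_subset ((W.support_subset_of_mem_vertexClosure hF hp).trans hz)
      ((W.support_subset_of_mem_vertexClosure hF hq).trans hz)⟩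
  · obtain ⟨h, a, -, ha⟩ := hx
    have hx (i : Fin n) : W.support (x i) ⊆ h • Set.range W.emb :=
      congrFun ha i ▸ W.support_smul_point_subset h (a i)
    exact ⟨h, Set.union_subset ((W.support_subset_of_mem_vertexClosure hF hp).trans (hx i))
      ((W.support_subset_of_mem_vertexClosure hF hq).trans (hx j))⟩

theorem isFaithfulEmb_witnessEmb (hF : ∀ n : ℕ, n ≠ 1 → IsEmpty (L.Functions n))
    (hW : W.IsConformal) : IsFaithfulEmb (W.witnessEmb hF) := by
  intro C _ hC
  obtain ⟨k, hk⟩ := hW (⋃ p ∈ C, W.support p) (by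
    simp only [Set.mem_iUnion₂]
    rintro b ⟨p, hp, hb⟩ b' ⟨q, hq, hb'⟩
    exact (W.inCopy_support_union hF hC ⟨p, hp⟩ ⟨q, hq⟩).mono
      (Set.pair_subset (Or.inl hb) (Or.inr hb')))
  refine ⟨W.witnessAut k⁻¹, ?_⟩
  rintro _ ⟨p, hp, rfl⟩
  obtain ⟨h, a, rfl⟩ := W.exists_smul_point p
  have hmem (x : A) (hx : x ∈ vertexClosure M a) : (k⁻¹ * h) • W.emb x ∈ Set.range W.emb := by
    rw [mul_smul, ← Set.mem_smul_set_iff_inv_smul_mem]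
    exact hk (Set.mem_biUnion hp (Set.smul_mem_smul_set (Set.mem_image_of_mem _ hx)))
  exact ⟨_, ((mul_smul _ _ _).symm.trans (W.smul_point (isSubstructure_vertexClosure M a) hmem
    (mem_vertexClosure M a))).symm⟩

end Realization

/-! ### Partial automorphisms of the embedded structure -/

section PullBack

variable {L : FirstOrder.Language.{u, v}} {A B : Type w} {Γ : Subgroup (LangPerm L)}
  {M : Str L A} {N : Str L B} {ψ : Emb Γ M N}

/-- The vertex set in `M` of a substructure of `ψ(M)`. -/
def pullSet (ψ : Emb Γ M N) (S : Set (Set.range ψ.toFun)) : Set A :=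
  {a | Set.rangeFactorization ψ.toFun a ∈ S}

/-- The identification of a substructure of `ψ(M)` with one of `M`. -/
noncomputable def pullSetEquiv (ψ : Emb Γ M N) (S : Set (Set.range ψ.toFun)) : pullSet ψ S ≃ S :=
  (Equiv.ofInjective ψ.toFun ψ.isEmbedding.injective).subtypeEquiv fun _ => Iff.rfl

theorem isSubstructure_pullSet {S : Set (Set.range ψ.toFun)} (hS : IsSubstructure ψ.image S) :
    IsSubstructure M (pullSet ψ S) := fun n F x hx y hy =>
  hS n (ψ.lang.1.1 n F) (fun i => Set.rangeFactorization ψ.toFun (x i)) hx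
    ((ψ.isEmbedding.mem_func_iff F x y).1 hy)

variable [Finite A]

/-- A partial automorphism of `ψ(M)`, extended to a permutation of the vertices of `M`. -/
noncomputable def vertexPerm (p : PartialAut Γ ψ.image) : Perm A :=
  extendPerm ((pullSetEquiv ψ p.dom).trans
    (p.iso.toEquiv.trans (pullSetEquiv ψ p.ran).symm))

theorem apply_vertexPerm (p : PartialAut Γ ψ.image) {a : A} (ha : a ∈ pullSet ψ p.dom) :
    ψ.toFun (vertexPerm p a) = p.iso.toEquiv ⟨⟨ψ.toFun a, a, rfl⟩, ha⟩ := by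
  have happly := extendPerm_apply ((pullSetEquiv ψ p.dom).trans
    (p.iso.toEquiv.trans (pullSetEquiv ψ p.ran).symm)) ⟨a, ha⟩
  have hval (z : pullSet ψ p.ran) : ψ.toFun z = (pullSetEquiv ψ p.ran z : Set.range ψ.toFun) := rfl
  rw [vertexPerm, happly, hval, Equiv.trans_apply, Equiv.trans_apply, Equiv.apply_symm_apply]
  rfl

theorem vertexPerm_image (p : PartialAut Γ ψ.image) :
    vertexPerm p '' pullSet ψ p.dom = pullSet ψ p.ran :=
  extendPerm_image _

theorem IsCoherentTriple.vertexPerm_eq {p q r : PartialAut Γ ψ.image}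
    (h : IsCoherentTriple p q r) : vertexPerm r = vertexPerm q * vertexPerm p := by
  obtain ⟨dom, mid, _, _, f⟩ := p
  obtain ⟨_, ran, _, _, g⟩ := q
  obtain ⟨_, _, _, _, k⟩ := r
  obtain ⟨hdom, hmid, hran, -, hmap⟩ := h
  dsimp only at hdom hmid hran
  subst hdom hmid hran
  rw [vertexPerm, vertexPerm, vertexPerm, ← extendPerm_trans]
  congr 1
  ext x
  have hk (x : dom) : k.toEquiv x = g.toEquiv (f.toEquiv x) := Subtype.ext (hmap x)
  simp [hk]

theorem vertexPerm_mem_pullSet_iff (p : PartialAut Γ ψ.image) {a : A} :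
    vertexPerm p a ∈ pullSet ψ p.ran ↔ a ∈ pullSet ψ p.dom := by
  rw [← vertexPerm_image, (vertexPerm p).injective.mem_set_image]

theorem mem_rel_iff_vertexPerm (hψ : IsEmbedding 1 ψ.toFun M N) (p : PartialAut Γ ψ.image) {n : ℕ}
    (R : L.Relations n) {x : Fin n → A} (hx : ∀ i, x i ∈ pullSet ψ p.dom) :
    x ∈ M.rel n R ↔ vertexPerm p ∘ x ∈ M.rel n ((p.iso.lang : LangPerm L).2 n R) := by
  have hpx : ψ.toFun ∘ vertexPerm p ∘ x =
      fun i => ((p.iso.toEquiv ⟨⟨ψ.toFun (x i), x i, rfl⟩, hx i⟩ : Set.range ψ.toFun) : B) :=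
    funext fun i => apply_vertexPerm p (hx i)
  rw [hψ.map_rel n R x, hψ.map_rel n _ (vertexPerm p ∘ x), hpx]
  exact p.iso.isEmbedding.map_rel n R fun i => ⟨⟨ψ.toFun (x i), x i, rfl⟩, hx i⟩

theorem mem_func_iff_vertexPerm (hψ : IsEmbedding 1 ψ.toFun M N) (p : PartialAut Γ ψ.image) {n : ℕ}
    (F : L.Functions n) {x : Fin n → A} (hx : ∀ i, x i ∈ pullSet ψ p.dom) {y : A}
    (hy : y ∈ pullSet ψ p.dom) :
    y ∈ M.func n F x ↔
      vertexPerm p y ∈ M.func n ((p.iso.lang : LangPerm L).1 n F) (vertexPerm p ∘ x) := by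
  have hpx : ψ.toFun ∘ vertexPerm p ∘ x =
      fun i => ((p.iso.toEquiv ⟨⟨ψ.toFun (x i), x i, rfl⟩, hx i⟩ : Set.range ψ.toFun) : B) :=
    funext fun i => apply_vertexPerm p (hx i)
  rw [hψ.mem_func_iff F x, hψ.mem_func_iff _ (vertexPerm p ∘ x), hpx, apply_vertexPerm p hy]
  exact p.iso.isEmbedding.mem_func_iff F (fun i => ⟨⟨ψ.toFun (x i), x i, rfl⟩, hx i⟩)
    ⟨⟨ψ.toFun y, y, rfl⟩, hy⟩

theorem isSymmetryOn_vertexPerm (hψ : IsEmbedding 1 ψ.toFun M N) (p : PartialAut Γ ψ.image) :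
    IsSymmetryOn M (pullSet ψ p.dom) (vertexPerm p, p.iso.lang) where
  rel n R x hx := mem_rel_iff_vertexPerm hψ p R hx
  func n F x hx := by
    ext y
    refine ⟨fun hy => (mem_func_iff_vertexPerm hψ p F hx ?_).1 hy,
      fun hy => (mem_func_iff_vertexPerm hψ p F hx ?_).2 hy⟩
    · exact isSubstructure_pullSet p.dom_sub n F x hx hy
    · exact (vertexPerm_mem_pullSet_iff p).1 (isSubstructure_pullSet p.ran_sub n _ _
        (fun i => (vertexPerm_mem_pullSet_iff p).2 (hx i)) hy)

end PullBack

namespace Realization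

variable {L : FirstOrder.Language.{u, v}} {A B : Type w} {Γ : Subgroup (LangPerm L)}
  {H : Type*} [Group H] [MulAction H B] {M : Str L A}
  (W : Realization (IsSymmetryOn (Γ := Γ) M) H B)

theorem extend_smul_point {D : Set A} (hD : IsSubstructure M D) {g : Perm A × Γ}
    (hg : IsSymmetryOn M D g) {a : A} (ha : a ∈ D) :
    W.extend D g hg • W.point a = W.point (g • a) := by
  rw [W.smul_point hD (fun x hx => ⟨_, (W.extend_smul_emb D g hg x hx).symm⟩) ha, W.label_extend]

variable [Finite A] (hF : ∀ n : ℕ, n ≠ 1 → IsEmpty (L.Functions n))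

/-- The element of `H` that extends a partial automorphism of the embedded copy of `A`. -/
noncomputable def extendPartialAut (p : PartialAut Γ (W.witnessEmb hF).image) : H :=
  W.extend (pullSet (W.witnessEmb hF) p.dom) (vertexPerm p, p.iso.lang)
    (isSymmetryOn_vertexPerm (W.witnessEmb hF).isEmbedding p)

theorem extends_extendPartialAut (p : PartialAut Γ (W.witnessEmb hF).image) :
    Extends (W.witnessAut (W.extendPartialAut hF p)) p := by
  refine ⟨congrArg Prod.snd (W.label_extend _ _ _), ?_⟩
  rintro ⟨⟨_, a, rfl⟩, ha⟩
  exact (W.extend_smul_point (isSubstructure_pullSet p.dom_sub) _ ha).trans (apply_vertexPerm p ha)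

theorem extendPartialAut_mul {p q r : PartialAut Γ (W.witnessEmb hF).image}
    (h : IsCoherentTriple p q r) :
    W.extendPartialAut hF r = W.extendPartialAut hF q * W.extendPartialAut hF p := by
  have hg : (vertexPerm r, r.iso.lang) =
      (vertexPerm q, q.iso.lang) * (vertexPerm p, p.iso.lang) :=
    Prod.ext h.vertexPerm_eq h.lang_eq
  have hE : (vertexPerm p, p.iso.lang) • pullSet (W.witnessEmb hF) p.dom =
      pullSet (W.witnessEmb hF) q.dom := by
    rw [← h.mid_eq]
    exact vertexPerm_image p
  simp only [extendPartialAut, ← h.dom_eq, hg]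
  exact W.extend_mul _ _ _ _ _ _ _ hE

theorem isCoherentEPPAEmb_witnessEmb : IsCoherentEPPAEmb (W.witnessEmb hF) := by
  refine ⟨fun p => W.witnessAut (W.extendPartialAut hF p), W.extends_extendPartialAut hF,
    fun p q r h => ?_⟩
  have hmul := W.extendPartialAut_mul hF h
  exact ⟨congrArg Prod.snd ((congrArg W.label hmul).trans (map_mul _ _ _)),
    fun x => (congrArg (· • x) hmul).trans (mul_smul _ _ _)⟩

end Realization

theorem exists_finite_faithful_coherent_witness {L : FirstOrder.Language.{u, v}}
    (hR : IsEmpty (L.Relations 0)) (hF : ∀ n : ℕ, n ≠ 1 → IsEmpty (L.Functions n))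
    {Γ : Subgroup (LangPerm L)} {A : Type w} [Finite A] {M : Str L A} (hM : InFiniteOrbit Γ M) :
    ∃ (B : Type w) (_ : Finite B) (N : Str L B), IsFaithfulCoherentEPPAWitness Γ M N := by
  obtain ⟨B, H, _, _, _, W, hW⟩ := exists_conformal_realization hR (hF 0 zero_ne_one) hM
  exact ⟨W.points, Subtype.finite, W.witness, W.witnessEmb hF, W.isCoherentEPPAEmb_witnessEmb hF,
    W.isFaithfulEmb_witnessEmb hF hW⟩

end GammaEPPA

theorem theorem1p1 (L : FirstOrder.Language.{u, v})
    (hR : IsEmpty (L.Relations 0))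
    (hF : ∀ n : ℕ, n ≠ 1 → IsEmpty (L.Functions n))
    (Γ : Subgroup (GammaEPPA.LangPerm L)) :
    (∀ (A : Type w) [Finite A] (M : GammaEPPA.Str L A), GammaEPPA.InFiniteOrbit Γ M →
      ∃ (B : Type w) (_ : Finite B) (N : GammaEPPA.Str L B),
        GammaEPPA.IsFaithfulCoherentEPPAWitness Γ M N) ∧
    ((∀ (A : Type w) [Finite A] (M : GammaEPPA.Str L A), GammaEPPA.InFiniteOrbit Γ M) →
      GammaEPPA.HasFaithfulCoherentEPPA Γ fun (A : Type w) (_ : GammaEPPA.Str L A) => Finite A) :=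
  ⟨fun _ _ _ hM => GammaEPPA.exists_finite_faithful_coherent_witness hR hF hM,
    fun h _ M _ => GammaEPPA.exists_finite_faithful_coherent_witness hR hF (h _ M) |>.imp
      fun _ ⟨hB, N, hN⟩ => ⟨N, hB, hN⟩⟩
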